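/- **Model.** A hybrid quantum-classical circuit has read-only classical input bits, classical work bits (initially $0$) and qubits, and is a sequence of parallel steps. A step consists either of classical AND gates, each writing the conjunction of two bits into a work bit (distinct gates of a step write to distinct work bits, and all read the values from before the step), or of arbitrary one- and two-qubit unitary gates acting on pairwise disjoint sets of qubits, each of which may be controlled by one classical bit. A classical bit may be read by any number of gates in one step. The depth is the number of steps, classical and quantum; the size is the number of gates, classical and quantum. For $k$-bit integers (unsigned, i.e. in $\{0,\dots,2^k-1\}$), write $|v\rangle$ for the computational basis state of $k$ qubits given by the binary digits of $v$, $QFT|z\rangle = 2^{-k/2}\sum_{v=0}^{2^k-1} e^{2\pi i z v/2^k}|v\rangle$, and $R_m=\mathrm{diag}(1,e^{2\pi i/2^m})$. **Theorem.** There is an absolute constant $c$ such that for all integers $n,k\ge 0$ there is a hybrid circuit $C$ with $k+a\le c\,k^3$ qubits ($k$ main and $a$ auxiliary ones) and depth at most $c\,(n+k)$, whose classical input bits hold $n$ pairs of $k$-bit integers $(x_1,y_1),\dots,(x_n,y_n)$, which performs $n$ multiply-additions exactly: for all $k$-bit integers $z$ and $x_i,y_i$ it maps $$|z\rangle\otimes|0^a\rangle\;\longmapsto\;\Big|\Big(z+\sum_{i=1}^n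 x_i y_i\Big)\bmod 2^k\Big\rangle\otimes|0^a\rangle .$$ Moreover $C$ can be taken to be a concatenation, in this order, of circuits $A$, $F$, $M(x_1,y_1),\dots,M(x_n,y_n)$, $F$, $A'$, where, for some map $\sigma:\{1,\dots,a\}\to\{1,\dots,k\}$: - $A$ maps $|z\rangle|0^a\rangle$ to $(QFT|z\rangle)|0^a\rangle$ and $A'$ maps $(QFT|z\rangle)|0^a\rangle$ to $|z\rangle|0^a\rangle$ for every $k$-bit integer $z$, and both have depth at most $c\,k$; - $F$ is the fan-out that adds main qubit $\sigma(i)$ modulo $2$ to auxiliary qubit $i$ for every $i$ (on all basis states), and has depth at most $c\,\lfloor\log_2 (k+1)\rfloor$; - $M(x,y)$ is one fixed circuit $M$ with its $2k$ classical inputs connected to the bits of $x$ and $y$. It has depth $2$, consisting of one layer of AND gates and one layer of classically controlled gates $R_m$, it has size at most $c\,k^3$, and, for all $k$-bit integers $x,y,v$, it multiplies the state obtained from $|v\rangle|0^a\rangle$ by the fan-out $F$ by the phase $e^{2\pi i x y v/2^k}$. -/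

import Mathlib

namespace QMAC

/-! ### The circuit model

A hybrid circuit has read-only classical input bits (indexed by `I`), classical work bits
(indexed by `W`), and qubits (indexed by `Q`).  A parallel step consists either of classical AND
gates or of one- and two-qubit unitary gates, each of which may be controlled by one classical bit.
A classical bit may be read by any number of gates in the same step; a qubit is acted upon by at
most one gate in each step. -/

/-- A one- or two-qubit quantum gate on qubits indexed by `Q`. -/
inductive QGate (Q : Type) where
  | one (U : Matrix.unitaryGroup Bool ℂ) (q : Q) : QGate Q
  | two (U : Matrix.unitaryGroup (Bool × Bool) ℂ) (p q : Q) (hpq : p ≠ q) : QGate Q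

/-- The qubits that a gate acts upon. -/
def QGate.qubits {Q : Type} : QGate Q → List Q
  | .one _ q => [q]
  | .two _ p q _ => [p, q]

/-- A (not necessarily normalised) pure state, by its amplitudes in the computational basis. -/
abbrev QState (Q : Type) : Type := (Q → Bool) → ℂ

/-- The computational basis state `|b⟩`. -/
def basisState {Q : Type} [Fintype Q] (b : Q → Bool) : QState Q :=
  Pi.single b 1

/-- The action of a gate on the states of the whole quantum register (tensored with the identity
on the other qubits). -/
def QGate.apply {Q : Type} [DecidableEq Q] (g : QGate Q) (ψ : QState Q) : QState Q :=
  match g with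
  | .one U q => fun b =>
      ∑ c : Bool, (U : Matrix Bool Bool ℂ) (b q) c * ψ (Function.update b q c)
  | .two U p q _ => fun b =>
      ∑ c : Bool × Bool, (U : Matrix (Bool × Bool) (Bool × Bool) ℂ) (b p, b q) c *
        ψ (Function.update (Function.update b p c.1) q c.2)

/-- A classical AND gate, which writes the conjunction of two bits into a work bit. -/
structure AndGate (I W : Type) where
  target : W
  left : I ⊕ W
  right : I ⊕ W

/-- A quantum gate that is applied always (`ctrl = none`), or if and only if the classical bit `c`
is `1` (`ctrl = some c`). -/
structure ControlledGate (I W Q : Type) where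
  ctrl : Option (I ⊕ W)
  gate : QGate Q

/-- One parallel step of a hybrid circuit. -/
inductive HybridLayer (I W Q : Type) where
  | classical (gates : List (AndGate I W)) (h : (gates.map AndGate.target).Nodup) :
      HybridLayer I W Q
  | quantum (gates : List (ControlledGate I W Q))
      (h : gates.Pairwise fun g g' => g.gate.qubits.Disjoint g'.gate.qubits) :
      HybridLayer I W Q

/-- A hybrid circuit is a sequence of parallel steps. -/
abbrev HybridCircuit (I W Q : Type) : Type := List (HybridLayer I W Q)

/-- The number of parallel steps, classical and quantum. -/
def HybridCircuit.depth {I W Q : Type} (C : HybridCircuit I W Q) : ℕ := C.length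

/-- The number of gates in a parallel step. -/
def HybridLayer.size {I W Q : Type} : HybridLayer I W Q → ℕ
  | .classical gates _ => gates.length
  | .quantum gates _ => gates.length

/-- The total number of gates, classical and quantum. -/
def HybridCircuit.size {I W Q : Type} (C : HybridCircuit I W Q) : ℕ :=
  (C.map HybridLayer.size).sum

/-- The action of a classically controlled gate, where `v` gives the values of all classical
bits. -/
def ControlledGate.apply {I W Q : Type} [DecidableEq Q] (v : I ⊕ W → Bool)
    (g : ControlledGate I W Q) (ψ : QState Q) : QState Q :=
  match g.ctrl with
  | none => g.gate.apply ψ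
  | some c => if v c = true then g.gate.apply ψ else ψ

/-- The action of one parallel step on the work bits and the quantum state, where `inp` gives the
values of the input bits.  All AND gates of a step read the values from before the step.  The gates
of a quantum step act on disjoint qubits, so their order is immaterial. -/
def HybridLayer.step {I W Q : Type} [DecidableEq W] [DecidableEq Q] (inp : I → Bool)
    (s : (W → Bool) × QState Q) : HybridLayer I W Q → (W → Bool) × QState Q
  | .classical gates _ =>
      (fun t => match gates.find? (fun g => decide (g.target = t)) with
        | some g => Sum.elim inp s.1 g.left && Sum.elim inp s.1 g.right
        | none => s.1 t, s.2)
  | .quantum gates _ =>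
      (s.1, gates.foldl (fun ψ g => g.apply (Sum.elim inp s.1) ψ) s.2)

/-- Running a hybrid circuit on the input bits `inp` from a given state of the work bits and of the
quantum register. -/
def HybridCircuit.run {I W Q : Type} [DecidableEq W] [DecidableEq Q] (C : HybridCircuit I W Q)
    (inp : I → Bool) (s : (W → Bool) × QState Q) : (W → Bool) × QState Q :=
  C.foldl (HybridLayer.step inp) s

/-- Connecting the classical inputs of an AND gate to other input bits. -/
def AndGate.relabel {I I' W : Type} (f : I → I') (g : AndGate I W) : AndGate I' W :=
  ⟨g.target, Sum.map f id g.left, Sum.map f id g.right⟩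

/-- Connecting the classical control of a quantum gate to another input bit. -/
def ControlledGate.relabel {I I' W Q : Type} (f : I → I') (g : ControlledGate I W Q) :
    ControlledGate I' W Q :=
  ⟨g.ctrl.map (Sum.map f id), g.gate⟩

/-- Connecting the classical inputs of a parallel step to other input bits. -/
def HybridLayer.relabel {I I' W Q : Type} (f : I → I') : HybridLayer I W Q → HybridLayer I' W Q
  | .classical gates h => .classical (gates.map (AndGate.relabel f)) (by
      have e : (AndGate.target ∘ AndGate.relabel f : AndGate I W → W) = AndGate.target := rfl
      rw [List.map_map, e]; exact h)
  | .quantum gates h => .quantum (gates.map (ControlledGate.relabel f)) (List.pairwise_map.2 h)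

/-- The same circuit with its classical inputs connected to other input bits. -/
def HybridCircuit.relabel {I I' W Q : Type} (f : I → I') (C : HybridCircuit I W Q) :
    HybridCircuit I' W Q :=
  C.map (HybridLayer.relabel f)

/-! ### Integers in registers -/

/-- The `k` lowest bits of an integer; index `0` is the least significant bit. -/
def bits (k z : ℕ) : Fin k → Bool := fun j => z.testBit j

/-- The integer with the given bits. -/
def bitsValue {k : ℕ} (b : Fin k → Bool) : ℕ := ∑ j : Fin k, (b j).toNat * 2 ^ (j : ℕ)

/-- Register content with `b` in the `k` main qubits and zeros in the `a` auxiliary qubits. -/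
def padded {k : ℕ} (a : ℕ) (b : Fin k → Bool) : Fin k ⊕ Fin a → Bool :=
  Sum.elim b (fun _ => false)

/-- The input bits that hold the integers `x` (left) and `y` (right). -/
def pairBits (k x y : ℕ) : Fin k ⊕ Fin k → Bool := Sum.elim (bits k x) (bits k y)

/-- The circuit maps `|z⟩|0⋯0⟩` to `|z + ∑ xᵢ yᵢ mod 2^k⟩|0⋯0⟩`, for all `k`-bit unsigned integers
`z` in the quantum register and `xᵢ`, `yᵢ` in the classical inputs; all work bits start as `0`. -/
def PerformsMultiplyAdds {n k a w : ℕ}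
    (C : HybridCircuit (Fin n × (Fin k ⊕ Fin k)) (Fin w) (Fin k ⊕ Fin a)) : Prop :=
  ∀ (x y : Fin n → Fin (2 ^ k)) (z : Fin (2 ^ k)),
    (C.run (fun p => pairBits k (x p.1) (y p.1) p.2)
      (fun _ => false, basisState (padded a (bits k z)))).2 =
    basisState (padded a (bits k (((z : ℕ) + ∑ i, (x i : ℕ) * (y i : ℕ)) % 2 ^ k)))

/-! ### The parts of the circuit -/

/-- The state `QFT|z⟩ ⊗ |0⋯0⟩`, where `QFT|z⟩ = 2^(-k/2) ∑_v exp(2πi z v / 2^k) |v⟩`. -/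
noncomputable def fourierState (k a z : ℕ) : QState (Fin k ⊕ Fin a) := fun b =>
  if ∀ i, b (Sum.inr i) = false then
    Complex.exp (2 * Real.pi * Complex.I * z * bitsValue (fun j => b (Sum.inl j)) / 2 ^ k) /
      (Real.sqrt (2 ^ k) : ℂ)
  else 0

/-- The circuit applies the quantum Fourier transform to the main qubits, the auxiliary qubits being
`0` before and after. -/
def ImplementsQFT {I : Type} {k a w : ℕ} (A : HybridCircuit I (Fin w) (Fin k ⊕ Fin a)) : Prop :=
  ∀ (inp : I → Bool) (u : Fin w → Bool) (z : Fin (2 ^ k)),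
    (A.run inp (u, basisState (padded a (bits k z)))).2 = fourierState k a z

/-- The circuit applies the inverse quantum Fourier transform to the main qubits, the auxiliary
qubits being `0` before and after. -/
def ImplementsInverseQFT {I : Type} {k a w : ℕ}
    (A : HybridCircuit I (Fin w) (Fin k ⊕ Fin a)) : Prop :=
  ∀ (inp : I → Bool) (u : Fin w → Bool) (z : Fin (2 ^ k)),
    (A.run inp (u, fourierState k a z)).2 = basisState (padded a (bits k z))

/-- The fan-out map: main qubit `σ i` is added modulo 2 to auxiliary qubit `i`, for every `i`. -/
def fanOut {k a : ℕ} (σ : Fin a → Fin k) (b : Fin k ⊕ Fin a → Bool) : Fin k ⊕ Fin a → Bool :=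
  Sum.elim (fun j => b (Sum.inl j)) (fun i => xor (b (Sum.inr i)) (b (Sum.inl (σ i))))

/-- The circuit applies the fan-out operator given by `σ`. -/
def ImplementsFanOut {I : Type} {k a w : ℕ} (σ : Fin a → Fin k)
    (F : HybridCircuit I (Fin w) (Fin k ⊕ Fin a)) : Prop :=
  ∀ (inp : I → Bool) (u : Fin w → Bool) (b : Fin k ⊕ Fin a → Bool),
    (F.run inp (u, basisState b)).2 = basisState (fanOut σ b)

/-- The phase shift gate `R_m = diag(1, exp(2πi / 2^m))`. -/
noncomputable def phaseGate (m : ℕ) : Matrix.unitaryGroup Bool ℂ :=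
  ⟨Matrix.diagonal fun c => if c then Complex.exp (2 * Real.pi * Complex.I / 2 ^ m) else 1, by
    rw [Matrix.mem_unitaryGroup_iff, Matrix.star_eq_conjTranspose, Matrix.diagonal_conjTranspose,
      Matrix.diagonal_mul_diagonal, ← Matrix.diagonal_one]
    congr 1
    funext c
    cases c
    · simp
    · have h : (2 * Real.pi * Complex.I / 2 ^ m : ℂ) =
          ((2 * Real.pi / 2 ^ m : ℝ) : ℂ) * Complex.I := by
        push_cast; ring
      simp only [Pi.star_apply, if_true, h]
      rw [← starRingEnd_apply, Complex.mul_conj, Complex.normSq_eq_norm_sq,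
        Complex.norm_exp_ofReal_mul_I]
      simp⟩

/-- The circuit consists of one layer of AND gates, followed by one layer of classically controlled
phase gates. -/
def IsPhaseCircuit {I W Q : Type} (M : HybridCircuit I W Q) : Prop :=
  ∃ (L : List (AndGate I W)) (hL : (L.map AndGate.target).Nodup)
    (G : List (ControlledGate I W Q))
    (hG : G.Pairwise fun g g' => g.gate.qubits.Disjoint g'.gate.qubits),
    M = [HybridLayer.classical L hL, HybridLayer.quantum G hG] ∧
    ∀ g ∈ G, ∃ (c : I ⊕ W) (m : ℕ) (q : Q), g = ⟨some c, QGate.one (phaseGate m) q⟩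

/-- On fanned-out basis states, the circuit acts as the phase operator
`|v⟩ ↦ exp(2πi x y v / 2^k) |v⟩`, for all `k`-bit integers `x`, `y` in the classical inputs. -/
def ImplementsMultiplyAddPhase {k a w : ℕ} (σ : Fin a → Fin k)
    (M : HybridCircuit (Fin k ⊕ Fin k) (Fin w) (Fin k ⊕ Fin a)) : Prop :=
  ∀ (x y : Fin (2 ^ k)) (u : Fin w → Bool) (b : Fin k → Bool),
    (M.run (pairBits k x y) (u, basisState (fanOut σ (padded a b)))).2 =
    Complex.exp (2 * Real.pi * Complex.I * (x : ℕ) * (y : ℕ) * bitsValue b / 2 ^ k) •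
      basisState (fanOut σ (padded a b))

end QMAC

/-!
In the Fourier basis the addition of `x * y` modulo `2 ^ k` is the diagonal operator
`|v⟩ ↦ exp (2πi x y v / 2 ^ k) |v⟩`. Expanding `x`, `y` and `v` in binary digits writes its phase as
a product over all triples `(i, j, l)` of rotations by `2π * 2 ^ (i + j + l) / 2 ^ k`, each applied
iff `x i ∧ y j ∧ v l` (`exp_mul_mul_bitsValue`). If each qubit `l` has `k ^ 2` copies, indexed by
`(i, j)`, then all these rotations act on different qubits, so that one layer of AND gates, which
computes the bits `x i ∧ y j`, and one layer of controlled gates `R_m` suffice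
(`implementsMultiplyAddPhase_productPhaseCircuit`). The copies are made once, before all
multiply-additions, and removed once, after them; by linearity the parts then combine to the whole
(`performsMultiplyAdds_of_parts`).

The fan-out has to be correct for arbitrary contents of the auxiliary qubits. Adding a main qubit to
its first copy, conjugated by `j` layers that each double the number of copies reached, adds it to
`2 ^ j` copies (`run_fanOutCircuit`).

The Fourier transform is the textbook circuit, with the bits reversed at the start. The gate on the
pair `p ≤ q` (a Hadamard gate if `p = q`, a controlled phase gate otherwise) is scheduled at time
`p + q`, which gives linear depth. The state after any number of layers is a product over the pairs
treated so far, restricted to the basis states that still agree with the input on the qubits without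
a Hadamard gate (`run_fourierCircuit`); once all pairs have been treated, this is the Fourier state
(`partialFourier_eq_fourierState`). The inverse transform is the inverse circuit.
-/

namespace QMAC

/-! ### Linearity of runs -/

section Linearity

variable {I W Q : Type} [DecidableEq Q]

theorem QGate.isLinearMap_apply (g : QGate Q) : IsLinearMap ℂ g.apply := by
  cases g <;> constructor <;> intros <;> funext b <;>
    simp only [QGate.apply, Pi.add_apply, Pi.smul_apply, smul_eq_mul, mul_add,
      Finset.sum_add_distrib, Finset.mul_sum, mul_left_comm]

theorem ControlledGate.isLinearMap_apply (v : I ⊕ W → Bool) (g : ControlledGate I W Q) :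
    IsLinearMap ℂ (g.apply v) := by
  obtain ⟨c, g⟩ := g
  cases c with
  | none => exact g.isLinearMap_apply
  | some c =>
    by_cases h : v c = true
    · have : ControlledGate.apply v ⟨some c, g⟩ = g.apply := by
        funext ψ; simp [ControlledGate.apply, h]
      rw [this]; exact g.isLinearMap_apply
    · have : ControlledGate.apply v ⟨some c, g⟩ = id := by
        funext ψ; simp [ControlledGate.apply, h]
      rw [this]; exact ⟨fun _ _ => rfl, fun _ _ => rfl⟩

theorem exists_linearMap_foldl_apply (v : I ⊕ W → Bool) (G : List (ControlledGate I W Q)) :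
    ∃ L : QState Q →ₗ[ℂ] QState Q, ∀ ψ, G.foldl (fun ψ g => g.apply v ψ) ψ = L ψ := by
  induction G with
  | nil => exact ⟨LinearMap.id, fun _ => rfl⟩
  | cons g G ih =>
    obtain ⟨L, hL⟩ := ih
    exact ⟨L.comp (IsLinearMap.mk' _ (g.isLinearMap_apply v)), fun ψ => hL _⟩

variable [DecidableEq W]

/-- The classical bits evolve independently of the quantum register, on which a circuit therefore
acts linearly. -/
theorem HybridCircuit.exists_linearMap_run (C : HybridCircuit I W Q) (inp : I → Bool)
    (u : W → Bool) :
    ∃ (u' : W → Bool) (L : QState Q →ₗ[ℂ] QState Q), ∀ ψ, C.run inp (u, ψ) = (u', L ψ) := by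
  induction C generalizing u with
  | nil => exact ⟨u, LinearMap.id, fun _ => rfl⟩
  | cons l C ih =>
    cases l with
    | classical G h =>
      obtain ⟨u', L, hL⟩ := ih (HybridLayer.step inp (u, (0 : QState Q)) (.classical G h)).1
      exact ⟨u', L, fun ψ => hL ψ⟩
    | quantum G h =>
      obtain ⟨L₀, h₀⟩ := exists_linearMap_foldl_apply (Sum.elim inp u) G
      obtain ⟨u', L, hL⟩ := ih u
      refine ⟨u', L.comp L₀, fun ψ => ?_⟩
      rw [LinearMap.comp_apply, ← h₀, ← hL]
      rfl

theorem HybridCircuit.run_append (C D : HybridCircuit I W Q)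
    (inp : I → Bool)
    (s : (W → Bool) × QState Q) : HybridCircuit.run (C ++ D) inp s = D.run inp (C.run inp s) :=
  List.foldl_append

theorem HybridCircuit.run_cons (l : HybridLayer I W Q) (C : HybridCircuit I W Q) (inp : I → Bool)
    (s : (W → Bool) × QState Q) :
    HybridCircuit.run (l :: C) inp s = C.run inp (HybridLayer.step inp s l) :=
  rfl

theorem HybridCircuit.run_sum_smul {ι : Type} [Fintype ι] (C : HybridCircuit I W Q)
    (inp : I → Bool) (u : W → Bool) (f g : ι → QState Q) (d : ι → ℂ)
    (h : ∀ i, (C.run inp (u, f i)).2 = d i • g i) (c : ι → ℂ) :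
    (C.run inp (u, ∑ i, c i • f i)).2 = ∑ i, (c i * d i) • g i := by
  obtain ⟨u', L, hL⟩ := C.exists_linearMap_run inp u
  simp only [hL] at h
  simp [hL, map_sum, h, smul_smul]

theorem HybridLayer.step_relabel {I' : Type} (f : I → I') (l : HybridLayer I W Q)
    (inp : I' → Bool) (s : (W → Bool) × QState Q) :
    HybridLayer.step inp s (l.relabel f) = HybridLayer.step (inp ∘ f) s l := by
  have key : ∀ x : I ⊕ W, Sum.elim inp s.1 (Sum.map f id x) = Sum.elim (inp ∘ f) s.1 x := by
    rintro (x | x) <;> rfl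
  cases l with
  | classical G h =>
    simp only [HybridLayer.relabel, HybridLayer.step, List.find?_map]
    refine Prod.ext (funext fun t => ?_) rfl
    have e : ((fun g : AndGate I' W => decide (g.target = t)) ∘ AndGate.relabel f) =
        fun g : AndGate I W => decide (g.target = t) := rfl
    simp only [e]
    cases List.find? (fun g : AndGate I W => decide (g.target = t)) G <;>
      simp [AndGate.relabel, key]
  | quantum G h =>
    simp only [HybridLayer.relabel, HybridLayer.step, List.foldl_map]
    congr 2
    funext ψ g
    obtain ⟨c, g⟩ := g
    cases c <;> simp [ControlledGate.relabel, ControlledGate.apply, key]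

theorem HybridCircuit.run_relabel {I' : Type} (f : I → I') (C : HybridCircuit I W Q)
    (inp : I' → Bool) (s : (W → Bool) × QState Q) :
    (C.relabel f).run inp s = C.run (inp ∘ f) s := by
  simp only [HybridCircuit.run, HybridCircuit.relabel, List.foldl_map,
    HybridLayer.step_relabel]

end Linearity

/-! ### Inverse circuits -/

section Inverse

variable {I W Q : Type}

/-- The inverse of a gate. -/
def QGate.inv : QGate Q → QGate Q
  | .one U q => .one U⁻¹ q
  | .two U p q h => .two U⁻¹ p q h

theorem QGate.inv_apply_apply [DecidableEq Q] (g : QGate Q) (ψ : QState Q) : g.inv.apply (g.apply ψ) = ψ := by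
  cases g with
  | one U q =>
    funext b
    have hU : ((U⁻¹ : Matrix.unitaryGroup Bool ℂ) : Matrix Bool Bool ℂ) *
        (U : Matrix Bool Bool ℂ) = 1 := by
      rw [← Matrix.UnitaryGroup.mul_val, inv_mul_cancel, Matrix.UnitaryGroup.one_val]
    simp only [QGate.inv, QGate.apply, Function.update_self, Function.update_idem, Finset.mul_sum]
    rw [Finset.sum_comm]
    simp only [← mul_assoc, ← Finset.sum_mul]
    simp only [← Matrix.mul_apply, hU, Matrix.one_apply, ite_mul, one_mul, zero_mul,
      Finset.sum_ite_eq, Finset.mem_univ, if_true, Function.update_eq_self]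
  | two U p q h =>
    funext b
    have hU : ((U⁻¹ : Matrix.unitaryGroup (Bool × Bool) ℂ) :
        Matrix (Bool × Bool) (Bool × Bool) ℂ) *
        (U : Matrix (Bool × Bool) (Bool × Bool) ℂ) = 1 := by
      rw [← Matrix.UnitaryGroup.mul_val, inv_mul_cancel, Matrix.UnitaryGroup.one_val]
    have hupd : ∀ c d : Bool × Bool,
        Function.update (Function.update (Function.update (Function.update b p c.1) q c.2) p d.1)
          q d.2 = Function.update (Function.update b p d.1) q d.2 := by
      intro c d
      rw [Function.update_comm h.symm, Function.update_idem, Function.update_idem]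
    have hU' : ∀ i j, ∑ c, ((U⁻¹ : Matrix.unitaryGroup (Bool × Bool) ℂ) :
        Matrix (Bool × Bool) (Bool × Bool) ℂ) i c *
        (U : Matrix (Bool × Bool) (Bool × Bool) ℂ) c j = if i = j then 1 else 0 := fun i j => by
      rw [← Matrix.mul_apply, hU, Matrix.one_apply]
    simp only [QGate.inv, QGate.apply, Function.update_self, Function.update_of_ne h, hupd,
      Finset.mul_sum]
    rw [Finset.sum_comm]
    simp only [← mul_assoc, ← Finset.sum_mul]
    refine (Finset.sum_congr rfl fun d _ => by rw [hU' (b p, b q) d]).trans ?_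
    simp only [ite_mul, one_mul, zero_mul, Finset.sum_ite_eq, Finset.mem_univ, if_true,
      Function.update_eq_self]

theorem QGate.qubits_inv (g : QGate Q) : g.inv.qubits = g.qubits := by
  cases g <;> rfl

/-- The inverse of a classically controlled gate. -/
def ControlledGate.inv (g : ControlledGate I W Q) : ControlledGate I W Q := ⟨g.ctrl, g.gate.inv⟩

theorem ControlledGate.inv_apply_apply [DecidableEq Q] (v : I ⊕ W → Bool) (g : ControlledGate I W Q)
    (ψ : QState Q) : g.inv.apply v (g.apply v ψ) = ψ := by
  obtain ⟨c, g⟩ := g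
  cases c with
  | none => exact g.inv_apply_apply ψ
  | some c =>
    by_cases h : v c = true <;>
      simp [ControlledGate.inv, ControlledGate.apply, h, QGate.inv_apply_apply]

theorem foldl_reverse_inv_apply [DecidableEq Q] (v : I ⊕ W → Bool) (G : List (ControlledGate I W Q))
    (ψ : QState Q) :
    (G.reverse.map ControlledGate.inv).foldl (fun ψ g => g.apply v ψ)
      (G.foldl (fun ψ g => g.apply v ψ) ψ) = ψ := by
  induction G generalizing ψ with
  | nil => rfl
  | cons g G ih =>
    rw [List.reverse_cons, List.map_append, List.foldl_append, List.foldl_cons, ih]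
    exact g.inv_apply_apply v ψ

/-- A circuit without classical steps has an inverse of the same depth: its layers in reverse order,
each gate replaced by its adjoint. -/
theorem HybridCircuit.exists_inverse [DecidableEq W] [DecidableEq Q]
    (C : HybridCircuit I W Q)
    (hC : ∀ l ∈ C, ∃ G h, l = HybridLayer.quantum G h) :
    ∃ C' : HybridCircuit I W Q, C'.depth = C.depth ∧
      ∀ inp u ψ, (C'.run inp (u, (C.run inp (u, ψ)).2)).2 = ψ := by
  suffices H : ∃ C' : HybridCircuit I W Q, C'.depth = C.depth ∧
      ∀ inp u ψ, (C.run inp (u, ψ)).1 = u ∧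
        C'.run inp (C.run inp (u, ψ)) = (u, ψ) by
    obtain ⟨C', h1, h2⟩ := H
    refine ⟨C', h1, fun inp u ψ => ?_⟩
    have h3 := h2 inp u ψ
    have h4 : (u, (C.run inp (u, ψ)).2) = C.run inp (u, ψ) := Prod.ext h3.1.symm rfl
    rw [h4, h3.2]
  induction C with
  | nil => exact ⟨[], rfl, fun _ _ _ => ⟨rfl, rfl⟩⟩
  | cons l C ih =>
    obtain ⟨C', h1, h2⟩ := ih fun l hl => hC l (List.mem_cons_of_mem _ hl)
    obtain ⟨G, h, rfl⟩ := hC l List.mem_cons_self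
    have hG : (G.reverse.map ControlledGate.inv).Pairwise
        fun g g' => g.gate.qubits.Disjoint g'.gate.qubits := by
      rw [List.pairwise_map, List.pairwise_reverse]
      refine h.imp fun hgg' => ?_
      simp only [ControlledGate.inv, QGate.qubits_inv]
      exact hgg'.symm
    refine ⟨C' ++ [.quantum _ hG], ?_, fun inp u ψ => ⟨?_, ?_⟩⟩
    · simp only [HybridCircuit.depth, List.length_append, List.length_cons] at *
      simp [h1]
    · exact (h2 inp u _).1
    · have : HybridCircuit.run (.quantum G h :: C) inp (u, ψ) =
        HybridCircuit.run C inp (u, G.foldl (fun ψ g => g.apply (Sum.elim inp u) ψ) ψ) := rfl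
      rw [this, HybridCircuit.run_append, (h2 inp u _).2]
      exact Prod.ext rfl (foldl_reverse_inv_apply _ G ψ)

end Inverse

/-! ### Correctness of the whole circuit from that of its parts -/

section Assembly

theorem fanOut_fanOut {k a : ℕ} (σ : Fin a → Fin k) (b : Fin k ⊕ Fin a → Bool) :
    fanOut σ (fanOut σ b) = b := by
  funext q
  cases q <;> simp [fanOut]

/-- The amplitude of `|v⟩` in `QFT|z⟩`. -/
noncomputable def fourierCoeff (k z : ℕ) (v : Fin k → Bool) : ℂ :=
  Complex.exp (2 * Real.pi * Complex.I * z * bitsValue v / 2 ^ k) / (Real.sqrt (2 ^ k) : ℂ)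

theorem fourierState_eq_sum (k a z : ℕ) :
    fourierState k a z = ∑ v : Fin k → Bool, fourierCoeff k z v • basisState (padded a v) := by
  funext b
  rw [Finset.sum_apply]
  simp only [Pi.smul_apply, basisState, Pi.single_apply, smul_eq_mul, mul_ite, mul_one, mul_zero]
  by_cases h : ∀ i, b (Sum.inr i) = false
  · have key : ∀ v : Fin k → Bool, b = padded a v ↔ (fun j => b (Sum.inl j)) = v := by
      intro v
      constructor
      · rintro rfl; rfl
      · rintro rfl
        funext q
        cases q with
        | inl j => rfl
        | inr i => exact h i
    simp only [key, Finset.sum_ite_eq, Finset.mem_univ, if_true]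
    simp [fourierState, fourierCoeff, h]
  · rw [Finset.sum_eq_zero]
    · simp only [fourierState, h, if_false]
    · intro v _
      rw [if_neg]
      rintro rfl
      exact h fun i => rfl

theorem fourierCoeff_mod (k z : ℕ) (v : Fin k → Bool) :
    fourierCoeff k (z % 2 ^ k) v = fourierCoeff k z v := by
  have h : (2 * Real.pi * Complex.I * z * bitsValue v / 2 ^ k : ℂ) =
      2 * Real.pi * Complex.I * (z % 2 ^ k : ℕ) * bitsValue v / 2 ^ k +
        (z / 2 ^ k * bitsValue v : ℕ) * (2 * Real.pi * Complex.I) := by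
    have hz : (z : ℂ) = (z % 2 ^ k : ℕ) + 2 ^ k * (z / 2 ^ k : ℕ) := by
      exact_mod_cast (Nat.mod_add_div z (2 ^ k)).symm
    have h2 : (2 ^ k : ℂ) ≠ 0 := pow_ne_zero _ two_ne_zero
    rw [hz]
    field_simp
    push_cast
    ring
  rw [fourierCoeff, fourierCoeff, h, Complex.exp_add, Complex.exp_nat_mul_two_pi_mul_I, mul_one]

theorem fourierCoeff_mul_prod_phase {n : ℕ} (k z : ℕ) (x y : Fin n → ℕ) (v : Fin k → Bool) :
    fourierCoeff k z v * ((List.finRange n).map fun i =>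
      Complex.exp (2 * Real.pi * Complex.I * x i * y i * bitsValue v / 2 ^ k)).prod =
    fourierCoeff k (z + ∑ i, x i * y i) v := by
  rw [← List.ofFn_eq_map, List.prod_ofFn, ← Complex.exp_sum, fourierCoeff, fourierCoeff,
    div_mul_eq_mul_div, ← Complex.exp_add]
  congr 2
  rw [← Finset.sum_div, ← add_div]
  congr 1
  push_cast
  rw [mul_add, add_mul, Finset.mul_sum, Finset.sum_mul]
  congr 1
  exact Finset.sum_congr rfl fun i _ => by ring

/-- A sequence of circuits that act by phases on the states `f v` acts by the product of these
phases. -/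
theorem run_flatMap_phases {I W Q ι V : Type} [DecidableEq W] [DecidableEq Q] [Fintype V]
    (D : ι → HybridCircuit I W Q) (inp : I → Bool) (f : V → QState Q) (d : ι → V → ℂ)
    (h : ∀ i u v, ((D i).run inp (u, f v)).2 = d i v • f v) (l : List ι) (u : W → Bool)
    (c : V → ℂ) :
    (HybridCircuit.run (l.flatMap D) inp (u, ∑ v, c v • f v)).2 =
      ∑ v, (c v * (l.map fun i => d i v).prod) • f v := by
  induction l generalizing u c with
  | nil => simp [HybridCircuit.run]
  | cons i l ih =>
    rw [List.flatMap_cons, HybridCircuit.run_append]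
    have h1 := (D i).run_sum_smul inp u f f (d i) (h i u) c
    rw [← Prod.mk.eta (p := HybridCircuit.run (D i) inp _), h1, ih]
    simp only [List.map_cons, List.prod_cons, mul_assoc]

/-- In the Fourier basis the multiply-additions are diagonal, so that they compose to the addition
of `∑ xᵢ yᵢ` modulo `2 ^ k`. -/
theorem performsMultiplyAdds_of_parts {n k a w : ℕ} {σ : Fin a → Fin k}
    {A F A' : HybridCircuit (Fin n × (Fin k ⊕ Fin k)) (Fin w) (Fin k ⊕ Fin a)}
    {M : HybridCircuit (Fin k ⊕ Fin k) (Fin w) (Fin k ⊕ Fin a)}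
    (hA : ImplementsQFT A) (hA' : ImplementsInverseQFT A') (hF : ImplementsFanOut σ F)
    (hM : ImplementsMultiplyAddPhase σ M) :
    PerformsMultiplyAdds
      (A ++ F ++ (List.finRange n).flatMap (fun i => M.relabel (Prod.mk i)) ++ F ++ A') := by
  intro x y z
  set inp : Fin n × (Fin k ⊕ Fin k) → Bool := fun p => pairBits k (x p.1) (y p.1) p.2
  have step : ∀ (C D : HybridCircuit (Fin n × (Fin k ⊕ Fin k)) (Fin w) (Fin k ⊕ Fin a))
      (s : (Fin w → Bool) × QState (Fin k ⊕ Fin a)) (ψ : QState (Fin k ⊕ Fin a)),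
      (C.run inp s).2 = ψ →
      ∃ u, (HybridCircuit.run (C ++ D) inp s).2 = (D.run inp (u, ψ)).2 := by
    rintro C D s ψ rfl
    exact ⟨(C.run inp s).1, by rw [HybridCircuit.run_append]⟩
  have h1 := hA inp (fun _ => false) z
  obtain ⟨u2, h2⟩ := step A F _ _ h1
  rw [fourierState_eq_sum, F.run_sum_smul inp u2 _ (fun v => basisState (fanOut σ (padded a v)))
    1 (fun v => by rw [hF, Pi.one_apply, one_smul])] at h2
  obtain ⟨u3, h3⟩ := step _ ((List.finRange n).flatMap fun i => M.relabel (Prod.mk i)) _ _ h2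
  rw [run_flatMap_phases _ inp _ (fun i v => Complex.exp
    (2 * Real.pi * Complex.I * (x i : ℕ) * (y i : ℕ) * bitsValue v / 2 ^ k)) ?_] at h3
  swap
  · intro i u v
    rw [HybridCircuit.run_relabel]
    exact hM (x i) (y i) u v
  obtain ⟨u4, h4⟩ := step _ F _ _ h3
  rw [F.run_sum_smul inp u4 _ (fun v => basisState (padded a v))
    1 (fun v => by rw [hF, fanOut_fanOut, Pi.one_apply, one_smul])] at h4
  obtain ⟨u5, h5⟩ := step _ A' _ _ h4
  rw [h5]
  simp only [Pi.one_apply, mul_one]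
  simp only [fourierCoeff_mul_prod_phase k z (fun i => (x i : ℕ)) (fun i => (y i : ℕ))]
  simp only [← fourierCoeff_mod k ((z : ℕ) + _)]
  rw [← fourierState_eq_sum]
  exact hA' inp u5 ⟨_, Nat.mod_lt _ (by positivity)⟩

end Assembly

/-! ### Layers of diagonal gates and of basis permutations -/

section Layers

variable {I W Q ι : Type}

/-- A parallel step of uncontrolled two-qubit gates `U i` on the disjoint pairs `p i`, `q i`. -/
noncomputable def pairLayer [Fintype ι] (U : ι → Matrix.unitaryGroup (Bool × Bool) ℂ)
    (p q : ι → Q) (hpq : ∀ i, p i ≠ q i)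
    (hdis : ∀ i j, i ≠ j → p i ≠ p j ∧ p i ≠ q j ∧ q i ≠ p j ∧ q i ≠ q j) :
    HybridLayer I W Q :=
  .quantum (Finset.univ.toList.map fun i => ⟨none, .two (U i) (p i) (q i) (hpq i)⟩) (by
    rw [List.pairwise_map]
    refine (Finset.nodup_toList _).pairwise_of_forall_ne fun i _ j _ hij => ?_
    obtain ⟨h1, h2, h3, h4⟩ := hdis i j hij
    simp [QGate.qubits, h1.symm, h2.symm, h3.symm, h4.symm])

theorem foldl_apply_of_diagonal [DecidableEq Q] (v : I ⊕ W → Bool)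
    (G : ι → ControlledGate I W Q) (d : ι → (Q → Bool) → ℂ)
    (h : ∀ i ψ, (G i).apply v ψ = fun b => d i b * ψ b) (l : List ι) (ψ : QState Q) :
    (l.map G).foldl (fun ψ g => g.apply v ψ) ψ = fun b => (l.map fun i => d i b).prod * ψ b := by
  induction l generalizing ψ with
  | nil => simp
  | cons i l ih =>
    rw [List.map_cons, List.foldl_cons, ih, h]
    funext b
    simp only [List.map_cons, List.prod_cons]
    ring

/-- A diagonal two-qubit gate. -/
noncomputable def diagonalGate (d : Bool × Bool → ℂ) (hd : ∀ c, d c * star (d c) = 1) :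
    Matrix.unitaryGroup (Bool × Bool) ℂ :=
  ⟨Matrix.diagonal d, by
    rw [Matrix.mem_unitaryGroup_iff, Matrix.star_eq_conjTranspose, Matrix.diagonal_conjTranspose,
      Matrix.diagonal_mul_diagonal, ← Matrix.diagonal_one]
    congr 1
    funext c
    exact hd c⟩

theorem step_pairLayer_diagonal [DecidableEq W] [DecidableEq Q] [Fintype ι]
    (d : ι → Bool × Bool → ℂ)
    (hd : ∀ i c, d i c * star (d i c) = 1) (p q : ι → Q) (hpq : ∀ i, p i ≠ q i)
    (hdis : ∀ i j, i ≠ j → p i ≠ p j ∧ p i ≠ q j ∧ q i ≠ p j ∧ q i ≠ q j)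
    (inp : I → Bool) (u : W → Bool) (ψ : QState Q) :
    HybridLayer.step inp (u, ψ)
      (pairLayer (fun i => diagonalGate (d i) (hd i)) p q hpq hdis) =
      (u, fun b => (∏ i, d i (b (p i), b (q i))) * ψ b) := by
  refine Prod.ext rfl ?_
  simp only [HybridLayer.step, pairLayer]
  rw [foldl_apply_of_diagonal _ _ fun i b => d i (b (p i), b (q i))]
  · simp only [Finset.prod_map_toList]
  · intro i ψ
    funext b
    simp only [ControlledGate.apply, QGate.apply, diagonalGate, Matrix.diagonal_apply, ite_mul,
      zero_mul, Finset.sum_ite_eq, Finset.mem_univ, if_true, Function.update_eq_self]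

/-- The two-qubit gate that permutes the basis states by an involution `e`. -/
def involutionGate (e : Bool × Bool → Bool × Bool) (he : Function.Involutive e) :
    Matrix.unitaryGroup (Bool × Bool) ℂ :=
  ⟨Matrix.of fun c d => if d = e c then 1 else 0, by
    rw [Matrix.mem_unitaryGroup_iff]
    ext c d
    simp only [Matrix.mul_apply, Matrix.star_apply, Matrix.of_apply, Matrix.one_apply, ite_mul,
      one_mul, zero_mul, Finset.sum_ite_eq', Finset.mem_univ, if_true, he.injective.eq_iff]
    split_ifs <;> simp⟩

theorem apply_involutionGate_basisState [DecidableEq Q] [Fintype Q]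
    (e : Bool × Bool → Bool × Bool) (he : Function.Involutive e) (p q : Q) (hpq : p ≠ q)
    (b : Q → Bool) :
    (QGate.two (involutionGate e he) p q hpq).apply (basisState b) =
      basisState (Function.update (Function.update b p (e (b p, b q)).1) q (e (b p, b q)).2) := by
  funext b'
  simp only [QGate.apply, involutionGate, Matrix.of_apply, ite_mul, one_mul, zero_mul,
    Finset.sum_ite_eq', Finset.mem_univ, if_true, basisState, Pi.single_apply]
  congr 1
  rw [eq_iff_iff]
  constructor
  · rintro rfl
    funext r
    by_cases hq : r = q
    · subst hq; simp [Function.update_of_ne hpq, he _]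
    · by_cases hp : r = p
      · subst hp; simp [Function.update_of_ne hpq, he _]
      · simp [hq, hp]
  · rintro rfl
    funext r
    by_cases hq : r = q
    · subst hq; simp [Function.update_of_ne hpq, he _]
    · by_cases hp : r = p
      · subst hp; simp [Function.update_of_ne hpq, he _]
      · simp [hq, hp]

/-- A layer of involutive basis permutations on disjoint pairs of qubits maps `|b⟩` to `|b'⟩` if
`b'` arises from `b` pair by pair. -/
theorem step_pairLayer_involution [DecidableEq W] [DecidableEq Q] [Fintype Q] [Fintype ι]
    (e : Bool × Bool → Bool × Bool) (he : Function.Involutive e) (p q : ι → Q)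
    (hpq : ∀ i, p i ≠ q i)
    (hdis : ∀ i j, i ≠ j → p i ≠ p j ∧ p i ≠ q j ∧ q i ≠ p j ∧ q i ≠ q j)
    (inp : I → Bool) (u : W → Bool) (b b' : Q → Bool)
    (hb : ∀ i, (b' (p i), b' (q i)) = e (b (p i), b (q i)))
    (hb' : ∀ r, (∀ i, r ≠ p i ∧ r ≠ q i) → b' r = b r) :
    HybridLayer.step inp (u, basisState b)
      (pairLayer (fun _ => involutionGate e he) p q hpq hdis) = (u, basisState b') := by
  refine Prod.ext rfl ?_
  simp only [HybridLayer.step, pairLayer]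
  -- After the gates of a list, `b` has changed to `b'` exactly on their qubits.
  suffices H : ∀ (l : List ι) (_ : l.Nodup) (b : Q → Bool)
      (_ : ∀ i ∈ l, (b' (p i), b' (q i)) = e (b (p i), b (q i)))
      (_ : ∀ r, (∀ i ∈ l, r ≠ p i ∧ r ≠ q i) → b' r = b r),
      (l.map fun i => (⟨none, .two (involutionGate e he) (p i) (q i) (hpq i)⟩ :
        ControlledGate I W Q)).foldl (fun ψ g => g.apply (Sum.elim inp u) ψ) (basisState b) =
        basisState b' from
    H _ (Finset.nodup_toList _) b (fun i _ => hb i)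
      (fun r hr => hb' r fun i => hr i (by simp))
  intro l hl
  induction l with
  | nil =>
    intro b _ h
    simp [funext fun r => h r (by simp)]
  | cons i l ih =>
    intro b h1 h2
    obtain ⟨hi, hl⟩ := List.nodup_cons.1 hl
    have h := h1 i List.mem_cons_self
    rw [List.map_cons, List.foldl_cons]
    simp only [ControlledGate.apply]
    rw [apply_involutionGate_basisState]
    refine ih hl _ (fun j hj => ?_) (fun r hr => ?_)
    · obtain ⟨d1, d2, d3, d4⟩ := hdis j i (by rintro rfl; exact hi hj)
      rw [h1 j (List.mem_cons_of_mem _ hj), Function.update_of_ne d2, Function.update_of_ne d1,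
        Function.update_of_ne d4, Function.update_of_ne d3]
    · rw [← h]
      by_cases hq : r = q i
      · subst hq; simp
      · by_cases hp : r = p i
        · subst hp; simp [Function.update_of_ne hq]
        · rw [Function.update_of_ne hq, Function.update_of_ne hp]
          refine h2 r fun j hj => ?_
          rcases List.mem_cons.1 hj with rfl | hj
          · exact ⟨hp, hq⟩
          · exact hr j hj

end Layers

/-! ### Fan-out in logarithmic depth -/

section FanOut

variable {I : Type} {k N w : ℕ}

theorem involutive_cnot :
    Function.Involutive fun c : Bool × Bool => (c.1, xor c.1 c.2) := by
  rintro ⟨_ | _, _ | _⟩ <;> rfl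

/-- The layer that adds each main qubit to its copy number `0`. Copy `t` of main qubit `l` is the
auxiliary qubit `N * l + t`. -/
noncomputable def rootLayer (I : Type) (k N w : ℕ) :
    HybridLayer I (Fin w) (Fin k ⊕ Fin (k * N)) :=
  pairLayer (ι := {i : Fin (k * N) // (i : ℕ) % N = 0}) (fun _ => involutionGate _ involutive_cnot)
    (fun i => Sum.inl i.1.divNat) (fun i => Sum.inr i.1) (by simp) (by
      rintro ⟨i, hi⟩ ⟨j, hj⟩ hij
      have hij' : i ≠ j := fun h => hij (Subtype.ext h)
      refine ⟨fun h => hij' ?_, by simp, by simp, by simpa using hij'⟩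
      have h' : (i : ℕ) / N = (j : ℕ) / N := congrArg Fin.val (Sum.inl.inj h)
      apply Fin.ext
      rw [← Nat.div_add_mod (i : ℕ) N, ← Nat.div_add_mod (j : ℕ) N, hi, hj, h'])

/-- The auxiliary qubit `2 ^ j` places before `i`. -/
def shiftBack (j : ℕ) (i : Fin (k * N)) : Fin (k * N) :=
  ⟨i - 2 ^ j, lt_of_le_of_lt (Nat.sub_le _ _) i.2⟩

theorem shiftBack_mod {j : ℕ} {i : Fin (k * N)} (h : 2 ^ j ≤ (i : ℕ) % N) :
    (shiftBack j i : ℕ) % N = (i : ℕ) % N - 2 ^ j := by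
  have hN : 0 < N := Nat.pos_of_ne_zero (by rintro rfl; exact absurd i.2 (by simp))
  have h2 := Nat.mod_lt (i : ℕ) hN
  have h3 : (shiftBack j i : ℕ) = ((i : ℕ) % N - 2 ^ j) + N * ((i : ℕ) / N) := by
    rw [← Nat.sub_add_comm h, Nat.mod_add_div]; rfl
  rw [h3, Nat.add_mul_mod_self_left, Nat.mod_eq_of_lt ((Nat.sub_le _ _).trans_lt h2)]

theorem shiftBack_divNat {j : ℕ} {i : Fin (k * N)} (h : 2 ^ j ≤ (i : ℕ) % N) :
    (shiftBack j i).divNat = i.divNat := by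
  have hN : 0 < N := Nat.pos_of_ne_zero (by rintro rfl; exact absurd i.2 (by simp))
  have h2 := Nat.mod_lt (i : ℕ) hN
  have h3 : (shiftBack j i : ℕ) = ((i : ℕ) % N - 2 ^ j) + N * ((i : ℕ) / N) := by
    rw [← Nat.sub_add_comm h, Nat.mod_add_div]; rfl
  apply Fin.ext
  rw [Fin.coe_divNat, Fin.coe_divNat, h3, Nat.add_mul_div_left _ _ hN,
    Nat.div_eq_of_lt ((Nat.sub_le _ _).trans_lt h2), zero_add]

/-- The layer that adds copy `t` of each main qubit to copy `t + 2 ^ j`, for all `t < 2 ^ j`. -/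
noncomputable def doublingLayer (I : Type) (k N w j : ℕ) :
    HybridLayer I (Fin w) (Fin k ⊕ Fin (k * N)) :=
  pairLayer (ι := {i : Fin (k * N) // 2 ^ j ≤ (i : ℕ) % N ∧ (i : ℕ) % N < 2 ^ (j + 1)})
    (fun _ => involutionGate _ involutive_cnot)
    (fun i => Sum.inr (shiftBack j i.1)) (fun i => Sum.inr i.1) (by
      rintro ⟨i, hi⟩ h
      have h1 := shiftBack_mod hi.1
      rw [Sum.inr.inj h] at h1
      exact (Nat.sub_lt ((Nat.two_pow_pos j).trans_le hi.1) (Nat.two_pow_pos j)).ne h1.symm) (by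
      rintro ⟨i, hi⟩ ⟨i', hi'⟩ hij
      have hij' : i ≠ i' := fun h => hij (Subtype.ext h)
      have h1 := shiftBack_mod hi.1
      have h2 := shiftBack_mod hi'.1
      have hp : 2 ^ (j + 1) = 2 ^ j * 2 := pow_succ _ _
      have h4 := Nat.mod_le (i : ℕ) N
      have h5 := Nat.mod_le (i' : ℕ) N
      refine ⟨fun h => hij' ?_, fun h => ?_, fun h => ?_, by simpa using hij'⟩
      · have h3 : (i : ℕ) - 2 ^ j = (i' : ℕ) - 2 ^ j := congrArg Fin.val (Sum.inr.inj h)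
        have := hi.1.trans h4
        have := hi'.1.trans h5
        exact Fin.ext (by omega)
      · rw [Sum.inr.inj h] at h1
        clear hij h
        dsimp only at h1 h2
        generalize (i : ℕ) % N = t at *
        generalize (i' : ℕ) % N = t' at *
        omega
      · rw [← Sum.inr.inj h] at h2
        clear hij h
        dsimp only at h1 h2
        generalize (i : ℕ) % N = t at *
        generalize (i' : ℕ) % N = t' at *
        omega)

theorem step_rootLayer (inp : I → Bool) (u : Fin w → Bool) (b : Fin k ⊕ Fin (k * N) → Bool) :
    HybridLayer.step inp (u, basisState b) (rootLayer I k N w) =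
      (u, basisState (Sum.elim (fun l => b (Sum.inl l)) fun i : Fin (k * N) =>
        if (i : ℕ) % N = 0 then xor (b (Sum.inl i.divNat)) (b (Sum.inr i)) else b (Sum.inr i))) := by
  refine step_pairLayer_involution _ involutive_cnot _ _ _ _ inp u b _ ?_ ?_
  · rintro ⟨i, hi⟩
    simp [hi]
  · rintro (l | i) h
    · rfl
    · have hi : ¬ (i : ℕ) % N = 0 := fun hi => (h ⟨i, hi⟩).2 rfl
      simp [hi]

theorem step_doublingLayer (j : ℕ) (inp : I → Bool) (u : Fin w → Bool)
    (b : Fin k ⊕ Fin (k * N) → Bool) :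
    HybridLayer.step inp (u, basisState b) (doublingLayer I k N w j) =
      (u, basisState (Sum.elim (fun l => b (Sum.inl l)) fun i : Fin (k * N) =>
        if 2 ^ j ≤ (i : ℕ) % N ∧ (i : ℕ) % N < 2 ^ (j + 1) then
          xor (b (Sum.inr (shiftBack j i))) (b (Sum.inr i)) else b (Sum.inr i))) := by
  refine step_pairLayer_involution _ involutive_cnot _ _ _ _ inp u b _ ?_ ?_
  · rintro ⟨i, hi⟩
    have h1 : ¬ (2 ^ j ≤ (shiftBack j i : ℕ) % N ∧ (shiftBack j i : ℕ) % N < 2 ^ (j + 1)) := by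
      rw [shiftBack_mod hi.1]
      have hp : 2 ^ (j + 1) = 2 ^ j * 2 := pow_succ _ _
      generalize (i : ℕ) % N = t at *
      omega
    simp only [Sum.elim_inr, if_neg h1, if_pos hi]
  · rintro (l | i) h
    · rfl
    · have hi : ¬ (2 ^ j ≤ (i : ℕ) % N ∧ (i : ℕ) % N < 2 ^ (j + 1)) :=
        fun hi => (h ⟨i, hi⟩).2 rfl
      simp only [Sum.elim_inr, if_neg hi]

/-- The circuit that adds each main qubit to its first `2 ^ j` copies: the addition to copy `0`,
conjugated by the doubling layers. -/
noncomputable def fanOutCircuit (I : Type) (k N w : ℕ) :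
    ℕ → HybridCircuit I (Fin w) (Fin k ⊕ Fin (k * N))
  | 0 => [rootLayer I k N w]
  | j + 1 => doublingLayer I k N w j :: (fanOutCircuit I k N w j ++ [doublingLayer I k N w j])

theorem depth_fanOutCircuit (j : ℕ) : (fanOutCircuit I k N w j).depth = 2 * j + 1 := by
  induction j with
  | zero => rfl
  | succ j ih =>
    simp only [HybridCircuit.depth, fanOutCircuit, List.length_cons, List.length_append,
      List.length_nil] at *
    omega

theorem run_fanOutCircuit (j : ℕ) (inp : I → Bool) (u : Fin w → Bool)
    (b : Fin k ⊕ Fin (k * N) → Bool) :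
    (fanOutCircuit I k N w j).run inp (u, basisState b) =
      (u, basisState (Sum.elim (fun l => b (Sum.inl l)) fun i : Fin (k * N) =>
        if (i : ℕ) % N < 2 ^ j then xor (b (Sum.inl i.divNat)) (b (Sum.inr i))
        else b (Sum.inr i))) := by
  induction j generalizing b with
  | zero =>
    have := step_rootLayer inp u b
    simpa [HybridCircuit.run, fanOutCircuit] using this
  | succ j ih =>
    rw [fanOutCircuit, HybridCircuit.run_cons, step_doublingLayer, HybridCircuit.run_append, ih,
      HybridCircuit.run_cons, step_doublingLayer]
    refine Prod.ext rfl (congrArg basisState ?_)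
    funext r
    rcases r with l | i
    · rfl
    simp only [Sum.elim_inl, Sum.elim_inr]
    have hp : 2 ^ (j + 1) = 2 ^ j * 2 := pow_succ _ _
    by_cases h1 : (i : ℕ) % N < 2 ^ j
    · have h2 : ¬ 2 ^ j ≤ (i : ℕ) % N := by omega
      have h3 : (i : ℕ) % N < 2 ^ (j + 1) := by omega
      simp [h1, h2, h3]
    · have h2 : 2 ^ j ≤ (i : ℕ) % N := by omega
      by_cases h3 : (i : ℕ) % N < 2 ^ (j + 1)
      · have h4 : (i : ℕ) % N - 2 ^ j < 2 ^ j := by omega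
        have h5 : ¬ 2 ^ j ≤ (i : ℕ) % N - 2 ^ j := by omega
        simp only [h1, h2, h3, h4, h5, shiftBack_mod h2, shiftBack_divNat h2, true_and, false_and,
          if_true, if_false]
        cases b (Sum.inr (shiftBack j i)) <;> simp
      · simp [h1, h3]

theorem implementsFanOut_fanOutCircuit {j : ℕ} (h : N ≤ 2 ^ j) :
    ImplementsFanOut (fun i : Fin (k * N) => i.divNat) (fanOutCircuit I k N w j) := by
  intro inp u b
  rw [run_fanOutCircuit]
  refine congrArg basisState ?_
  funext r
  rcases r with l | i
  · rfl
  have hN : 0 < N := Nat.pos_of_ne_zero (by rintro rfl; exact absurd i.2 (by simp))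
  have h1 : (i : ℕ) % N < 2 ^ j := (Nat.mod_lt _ hN).trans_le h
  simp [fanOut, h1, Bool.xor_comm]

theorem exists_fanOut (I : Type) (k w : ℕ) :
    ∃ F : HybridCircuit I (Fin w) (Fin k ⊕ Fin (k * (k * k))),
      ImplementsFanOut (fun i : Fin (k * (k * k)) => i.divNat) F ∧
        F.depth ≤ 9 * Nat.log 2 (k + 1) := by
  rcases Nat.eq_zero_or_pos k with rfl | hk
  · refine ⟨[], fun inp u b => ?_, by simp [HybridCircuit.depth]⟩
    change basisState b = _
    refine congrArg basisState (funext fun r => ?_)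
    rcases r with l | i
    · exact l.elim0
    · exact absurd i.2 (by simp)
  · have h1 : k + 1 < 2 ^ (Nat.log 2 (k + 1) + 1) := Nat.lt_pow_succ_log_self (by norm_num) _
    have h2 : 1 ≤ Nat.log 2 (k + 1) := Nat.log_pos (by norm_num) (by omega)
    refine ⟨fanOutCircuit I k (k * k) w (2 * (Nat.log 2 (k + 1) + 1)),
      implementsFanOut_fanOutCircuit ?_, ?_⟩
    · rw [two_mul, pow_add]
      exact Nat.mul_le_mul (by omega) (by omega)
    · rw [depth_fanOutCircuit]
      omega

end FanOut

/-! ### Phases with binary digits -/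

section Phase

theorem bitsValue_bits_mod (k z : ℕ) : bitsValue (bits k z) = z % 2 ^ k := by
  induction k with
  | zero => simp [bitsValue, Nat.mod_one]
  | succ k ih =>
    have h : bitsValue (bits (k + 1) z) = bitsValue (bits k z) + (z.testBit k).toNat * 2 ^ k := by
      simp [bitsValue, bits, Fin.sum_univ_castSucc]
    rw [h, ih, Nat.pow_succ, Nat.mod_mul, Nat.toNat_testBit, mul_comm]

theorem bitsValue_bits {k z : ℕ} (hz : z < 2 ^ k) : bitsValue (bits k z) = z := by
  rw [bitsValue_bits_mod, Nat.mod_eq_of_lt hz]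

/-- The phase `exp (2πi / 2 ^ m)` of the gate `R_m`. -/
noncomputable def dyadicPhase (m : ℕ) : ℂ := Complex.exp (2 * Real.pi * Complex.I / 2 ^ m)

theorem exp_two_pow_div_two_pow (e k : ℕ) :
    Complex.exp (2 * Real.pi * Complex.I * (2 ^ e / 2 ^ k)) = dyadicPhase (k - e) := by
  have h2 : ∀ m : ℕ, (2 ^ m : ℂ) ≠ 0 := fun m => pow_ne_zero _ two_ne_zero
  rcases le_total e k with h | h
  · obtain ⟨d, rfl⟩ := Nat.exists_eq_add_of_le h
    rw [Nat.add_sub_cancel_left, dyadicPhase]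
    congr 1
    have := h2 e
    have := h2 d
    rw [pow_add]
    field_simp
  · obtain ⟨d, rfl⟩ := Nat.exists_eq_add_of_le h
    have h3 : (2 * Real.pi * Complex.I * (2 ^ (k + d) / 2 ^ k) : ℂ) =
        (2 ^ d : ℕ) * (2 * Real.pi * Complex.I) := by
      have := h2 k
      push_cast
      rw [pow_add]
      field_simp
    rw [h3, Complex.exp_nat_mul_two_pi_mul_I, Nat.sub_eq_zero_of_le h, dyadicPhase, pow_zero,
      div_one, Complex.exp_two_pi_mul_I]

/-- A phase in which a bit `b` occurs with weight `2 ^ e / 2 ^ k`. The subtraction may truncate,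
since integer multiples of the full angle contribute nothing. -/
theorem exp_toNat_mul_two_pow (b : Bool) (e k : ℕ) :
    Complex.exp (2 * Real.pi * Complex.I * (b.toNat * (2 ^ e / 2 ^ k))) =
      if b then dyadicPhase (k - e) else 1 := by
  cases b
  · simp
  · simpa using exp_two_pow_div_two_pow e k

theorem exp_mul_bitsValue {k : ℕ} (x v : Fin k → Bool) :
    Complex.exp (2 * Real.pi * Complex.I * bitsValue x * bitsValue v / 2 ^ k) =
      ∏ l, ∏ j, if v l && x j then dyadicPhase (k - (j + l)) else 1 := by
  simp only [← exp_toNat_mul_two_pow, ← Complex.exp_sum, ← Finset.mul_sum]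
  congr 1
  rw [mul_assoc, mul_div_assoc]
  congr 1
  simp only [bitsValue]
  push_cast
  have h : ∀ l j : Fin k, ((v l && x j).toNat : ℂ) * (2 ^ (j + l : ℕ) / 2 ^ k) =
      (x j).toNat * 2 ^ (j : ℕ) * ((v l).toNat * 2 ^ (l : ℕ)) / 2 ^ k := by
    intro l j
    cases x j <;> cases v l <;> simp [pow_add]
  simp only [h, ← Finset.mul_sum, ← Finset.sum_mul, ← Finset.sum_div]

theorem exp_mul_mul_bitsValue {k : ℕ} (x y v : Fin k → Bool) :
    Complex.exp (2 * Real.pi * Complex.I * bitsValue x * bitsValue y * bitsValue v / 2 ^ k) =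
      ∏ l, ∏ i, ∏ j, if x i && y j && v l then dyadicPhase (k - (i + j + l)) else 1 := by
  simp only [← exp_toNat_mul_two_pow, ← Complex.exp_sum, ← Finset.mul_sum]
  congr 1
  rw [mul_assoc, mul_assoc, mul_div_assoc]
  congr 1
  simp only [bitsValue]
  push_cast
  have h : ∀ l i j : Fin k, ((x i && y j && v l).toNat : ℂ) * (2 ^ (i + j + l : ℕ) / 2 ^ k) =
      (x i).toNat * 2 ^ (i : ℕ) * ((y j).toNat * 2 ^ (j : ℕ)) * ((v l).toNat * 2 ^ (l : ℕ)) /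
        2 ^ k := by
    intro l i j
    cases x i <;> cases y j <;> cases v l <;> simp [pow_add]
  simp only [h, ← Finset.mul_sum, ← Finset.sum_mul, ← Finset.sum_div]
  ring

end Phase

/-! ### One multiply-addition in the Fourier basis -/

section MultiplyAddPhase

theorem prod_divNat_modNat {M : Type} [CommMonoid M] {m n : ℕ} (f : Fin m → Fin n → M) :
    ∏ r : Fin (m * n), f r.divNat r.modNat = ∏ i, ∏ j, f i j := by
  rw [← Fintype.prod_prod_type', ← finProdFinEquiv.symm.prod_comp]
  rfl

/-- The gates that write `x i ∧ y j` into work bit `k * i + j`. -/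
def productAndGates (k : ℕ) : List (AndGate (Fin k ⊕ Fin k) (Fin (k * k))) :=
  (List.finRange (k * k)).map fun t => ⟨t, .inl (.inl t.divNat), .inl (.inr t.modNat)⟩

/-- The gates that rotate the copy `(i, j)` of main qubit `l` by the angle
`2π * 2 ^ (i + j + l) / 2 ^ k`, controlled by `x i ∧ y j`. If `i + j + l ≥ k`, then the gate is
`R_0`, which is the identity. -/
noncomputable def productPhaseGates (k : ℕ) :
    List (ControlledGate (Fin k ⊕ Fin k) (Fin (k * k)) (Fin k ⊕ Fin (k * (k * k)))) :=
  (List.finRange (k * (k * k))).map fun r =>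
    ⟨some (.inr r.modNat),
      .one (phaseGate (k - (r.modNat.divNat + r.modNat.modNat + r.divNat))) (.inr r)⟩

theorem nodup_productAndGates (k : ℕ) : ((productAndGates k).map AndGate.target).Nodup := by
  rw [productAndGates, List.map_map]
  exact (List.nodup_finRange _).map Function.injective_id

theorem pairwise_productPhaseGates (k : ℕ) :
    (productPhaseGates k).Pairwise fun g g' => g.gate.qubits.Disjoint g'.gate.qubits := by
  rw [productPhaseGates, List.pairwise_map]
  refine (List.nodup_finRange _).imp fun h => ?_
  simpa [QGate.qubits] using Ne.symm h

/-- The circuit `M` of a single multiply-addition in the Fourier basis. -/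
noncomputable def productPhaseCircuit (k : ℕ) :
    HybridCircuit (Fin k ⊕ Fin k) (Fin (k * k)) (Fin k ⊕ Fin (k * (k * k))) :=
  [.classical (productAndGates k) (nodup_productAndGates k),
    .quantum (productPhaseGates k) (pairwise_productPhaseGates k)]

theorem isPhaseCircuit_productPhaseCircuit (k : ℕ) : IsPhaseCircuit (productPhaseCircuit k) := by
  refine ⟨_, _, _, _, rfl, fun g hg => ?_⟩
  obtain ⟨r, -, rfl⟩ := List.mem_map.1 hg
  exact ⟨_, _, _, rfl⟩

theorem size_productPhaseCircuit (k : ℕ) : (productPhaseCircuit k).size ≤ 2 * k ^ 3 := by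
  have h : (productPhaseCircuit k).size = k * k + k * (k * k) := by
    simp [productPhaseCircuit, HybridCircuit.size, HybridLayer.size, productAndGates,
      productPhaseGates]
  rw [h]
  rcases Nat.eq_zero_or_pos k with rfl | hk
  · simp
  · nlinarith [Nat.mul_le_mul_right (k * k) hk]

theorem apply_phaseGate {Q : Type} [DecidableEq Q] (m : ℕ) (q : Q) (ψ : QState Q) :
    (QGate.one (phaseGate m) q).apply ψ = fun b => (if b q then dyadicPhase m else 1) * ψ b := by
  funext b
  simp only [QGate.apply, phaseGate, Matrix.diagonal_apply, ite_mul, zero_mul,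
    Finset.sum_ite_eq, Finset.mem_univ, if_true, Function.update_eq_self, dyadicPhase]

theorem step_productAndGates {Q : Type} [DecidableEq Q] (k : ℕ) (inp : Fin k ⊕ Fin k → Bool)
    (u : Fin (k * k) → Bool) (ψ : QState Q) :
    HybridLayer.step inp (u, ψ) (.classical (productAndGates k) (nodup_productAndGates k)) =
      (fun t => inp (.inl t.divNat) && inp (.inr t.modNat), ψ) := by
  refine Prod.ext (funext fun t => ?_) rfl
  have h : (productAndGates k).find? (fun g => decide (g.target = t)) =
      some ⟨t, .inl (.inl t.divNat), .inl (.inr t.modNat)⟩ := by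
    rw [productAndGates, List.find?_map]
    have h2 : (List.finRange (k * k)).find? (fun t' => decide (t' = t)) = some t := by
      cases h3 : (List.finRange (k * k)).find? (fun t' => decide (t' = t)) with
      | none => simpa using List.find?_eq_none.1 h3 t (List.mem_finRange t)
      | some t' => simpa using List.find?_some h3
    exact congrArg (Option.map _) h2
  simp only [HybridLayer.step, h]
  rfl

theorem implementsMultiplyAddPhase_productPhaseCircuit (k : ℕ) :
    ImplementsMultiplyAddPhase (fun i : Fin (k * (k * k)) => i.divNat)
      (productPhaseCircuit k) := by
  intro x y u b
  have hstep : ((productPhaseCircuit k).run (pairBits k x y) (u,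
      basisState (fanOut (fun i : Fin (k * (k * k)) => i.divNat) (padded _ b)))).2 =
      (productPhaseGates k).foldl (fun ψ g => g.apply (Sum.elim (pairBits k x y)
        fun t => bits k x t.divNat && bits k y t.modNat) ψ)
        (basisState (fanOut (fun i : Fin (k * (k * k)) => i.divNat) (padded _ b))) := by
    rw [productPhaseCircuit, HybridCircuit.run_cons, step_productAndGates]
    rfl
  rw [hstep, productPhaseGates, foldl_apply_of_diagonal _ _ fun r b' =>
    if (bits k x r.modNat.divNat && bits k y r.modNat.modNat) && b' (.inr r) then
      dyadicPhase (k - (r.modNat.divNat + r.modNat.modNat + r.divNat)) else 1]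
  · funext b'
    simp only [Pi.smul_apply, smul_eq_mul]
    by_cases hb : b' = fanOut (fun i : Fin (k * (k * k)) => i.divNat) (padded _ b)
    · subst hb
      congr 1
      have e := exp_mul_mul_bitsValue (bits k x) (bits k y) b
      rw [bitsValue_bits x.2, bitsValue_bits y.2] at e
      rw [e, ← List.ofFn_eq_map, List.prod_ofFn]
      simp only [fanOut, padded, Sum.elim_inr, Sum.elim_inl, Bool.false_xor]
      rw [prod_divNat_modNat fun (l : Fin k) (t : Fin (k * k)) =>
        if (bits k x t.divNat && bits k y t.modNat) && b l then
          dyadicPhase (k - (t.divNat + t.modNat + l)) else 1]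
      refine Finset.prod_congr rfl fun l _ => ?_
      rw [prod_divNat_modNat fun (i j : Fin k) =>
        if (bits k x i && bits k y j) && b l then dyadicPhase (k - (i + j + l)) else 1]
    · simp [basisState, hb]
  · intro r ψ
    simp only [ControlledGate.apply, apply_phaseGate, Sum.elim_inr]
    funext b'
    by_cases h : (bits k x r.modNat.divNat && bits k y r.modNat.modNat) = true <;> simp [h]

end MultiplyAddPhase

/-! ### The Fourier transform in linear depth -/

section Fourier

theorem dyadicPhase_zero : dyadicPhase 0 = 1 := by
  simp [dyadicPhase, Complex.exp_two_pi_mul_I]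

theorem dyadicPhase_one : dyadicPhase 1 = -1 := by
  rw [dyadicPhase, pow_one, mul_assoc, mul_div_cancel_left₀ _ two_ne_zero, Complex.exp_pi_mul_I]

theorem dyadicPhase_mul_star (m : ℕ) : dyadicPhase m * star (dyadicPhase m) = 1 := by
  have h : (2 * Real.pi * Complex.I / 2 ^ m : ℂ) =
      ((2 * Real.pi / 2 ^ m : ℝ) : ℂ) * Complex.I := by
    push_cast; ring
  rw [dyadicPhase, h, ← starRingEnd_apply, Complex.mul_conj, Complex.normSq_eq_norm_sq,
    Complex.norm_exp_ofReal_mul_I]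
  simp

/-- The Hadamard gate. -/
noncomputable def hadamard : Matrix.unitaryGroup Bool ℂ :=
  ⟨Matrix.of fun c d => (Real.sqrt 2 : ℂ)⁻¹ * if c && d then dyadicPhase 1 else 1, by
    have h : (Real.sqrt 2 : ℂ)⁻¹ * (Real.sqrt 2 : ℂ)⁻¹ = 2⁻¹ := by
      rw [← mul_inv, ← Complex.ofReal_mul, Real.mul_self_sqrt zero_le_two, Complex.ofReal_ofNat]
    rw [Matrix.mem_unitaryGroup_iff]
    ext c d
    cases c <;> cases d <;>
      (simp [Matrix.mul_apply, dyadicPhase_one, h]; try norm_num)⟩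

variable {I : Type} {k a w : ℕ}

theorem involutive_swap : Function.Involutive (Prod.swap : Bool × Bool → Bool × Bool) :=
  fun _ => rfl

/-- The layer that reverses the order of the main qubits. -/
noncomputable def reversalLayer (I : Type) (k a w : ℕ) : HybridLayer I (Fin w) (Fin k ⊕ Fin a) :=
  pairLayer (ι := {j : Fin k // j < j.rev}) (fun _ => involutionGate _ involutive_swap)
    (fun j => Sum.inl j.1) (fun j => Sum.inl j.1.rev)
    (fun j h => j.2.ne (Sum.inl.inj h)) (by
      rintro ⟨i, hi⟩ ⟨j, hj⟩ hij
      have hij' : i ≠ j := fun h => hij (Subtype.ext h)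
      simp only [ne_eq, Sum.inl.injEq, Fin.rev_inj]
      refine ⟨hij', ?_, ?_, hij'⟩
      · rintro rfl
        rw [Fin.rev_rev] at hi
        exact lt_asymm hi hj
      · rintro rfl
        rw [Fin.rev_rev] at hj
        exact lt_asymm hi hj)

theorem step_reversalLayer (inp : I → Bool) (u : Fin w → Bool) (b : Fin k → Bool) :
    HybridLayer.step inp (u, basisState (padded a b)) (reversalLayer I k a w) =
      (u, basisState (padded a fun j => b j.rev)) := by
  refine step_pairLayer_involution _ involutive_swap _ _ _ _ inp u _ _ ?_ ?_
  · rintro ⟨j, hj⟩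
    simp [padded]
  · rintro (j | i) h
    · have h1 : ¬ j < j.rev := fun hj => (h ⟨j, hj⟩).1 rfl
      have h2 : ¬ j.rev < j := fun hj =>
        (h ⟨j.rev, by rwa [Fin.rev_rev]⟩).2 (by simp only [Fin.rev_rev])
      have h3 : j.rev = j := le_antisymm (not_lt.1 h1) (not_lt.1 h2)
      simp [padded, h3]
    · rfl

/-- The layer of one Hadamard gate, on main qubit `s`. -/
noncomputable def hadamardLayer (I : Type) (a w : ℕ) (s : Fin k) :
    HybridLayer I (Fin w) (Fin k ⊕ Fin a) :=
  .quantum [⟨none, .one hadamard (.inl s)⟩] (List.pairwise_singleton _ _)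

/-- The layer of the controlled phase gates of the Fourier transform on those pairs of main qubits
whose indices have the sum `t`. -/
noncomputable def controlledPhaseLayer (I : Type) (k a w t : ℕ) :
    HybridLayer I (Fin w) (Fin k ⊕ Fin a) :=
  pairLayer (ι := {x : Fin k × Fin k // x.1 < x.2 ∧ (x.1 + x.2 : ℕ) = t})
    (fun x => diagonalGate (fun c => if c.1 && c.2 then dyadicPhase (x.1.2 + 1 - x.1.1) else 1) (by
      intro c
      by_cases h : (c.1 && c.2) = true
      · simpa only [h, if_true] using dyadicPhase_mul_star _
      · simp [h]))
    (fun x => Sum.inl x.1.1) (fun x => Sum.inl x.1.2) (fun x h => x.2.1.ne (Sum.inl.inj h)) (by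
      rintro ⟨⟨p, q⟩, h1, h2⟩ ⟨⟨p', q'⟩, h1', h2'⟩ hne
      have hne' : ¬ (p = p' ∧ q = q') := by
        rintro ⟨rfl, rfl⟩
        exact hne rfl
      have h3 : (p : ℕ) < q := h1
      have h4 : (p' : ℕ) < q' := h1'
      have h5 : (p + q : ℕ) = t := h2
      have h6 : (p' + q' : ℕ) = t := h2'
      clear hne
      simp only [ne_eq, Sum.inl.injEq, Fin.ext_iff] at *
      omega)

/-- The factor that the gate on the pair `x` contributes to an amplitude of the Fourier transform:
the Hadamard gate if `x.1 = x.2`, and a controlled phase gate otherwise. Here `c` is a bit of the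
output, and `d` is a bit of the input. -/
noncomputable def fourierFactor (x : Fin k × Fin k) (c d : Bool) : ℂ :=
  (if x.1 = x.2 then (Real.sqrt 2 : ℂ)⁻¹ else 1) *
    if c && d then dyadicPhase (x.2 + 1 - x.1) else 1

/-- The state reached from `|d⟩` when the gates on the pairs in `R` have been applied, with Hadamard
gates on exactly the first `m` qubits. -/
noncomputable def partialFourier (a : ℕ) (d : Fin k → Bool) (R : Finset (Fin k × Fin k)) (m : ℕ) :
    QState (Fin k ⊕ Fin a) := fun b =>
  if (∀ i, b (.inr i) = false) ∧ ∀ p : Fin k, m ≤ p → b (.inl p) = d p then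
    ∏ x ∈ R, fourierFactor x (b (.inl x.1)) (d x.2)
  else 0

theorem partialFourier_empty (d : Fin k → Bool) :
    partialFourier a d ∅ 0 = basisState (padded a d) := by
  funext b
  simp only [partialFourier, Finset.prod_empty, basisState, Pi.single_apply]
  congr 1
  rw [eq_iff_iff]
  constructor
  · rintro ⟨h1, h2⟩
    funext r
    rcases r with p | i
    · exact h2 p (Nat.zero_le _)
    · exact h1 i
  · rintro rfl
    exact ⟨fun _ => rfl, fun _ _ => rfl⟩

theorem step_hadamardLayer (d : Fin k → Bool) (R : Finset (Fin k × Fin k)) (s : Fin k)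
    (hR : ∀ x ∈ R, x.1 < s) (inp : I → Bool) (u : Fin w → Bool) :
    HybridLayer.step inp (u, partialFourier a d R s) (hadamardLayer I a w s) =
      (u, partialFourier a d (insert (s, s) R) (s + 1)) := by
  refine Prod.ext rfl (funext fun b => ?_)
  have h1 : ∀ c : Bool, partialFourier a d R s (Function.update b (.inl s) c) =
      if c = d s then (if (∀ i, b (.inr i) = false) ∧ ∀ p : Fin k, (s + 1 : ℕ) ≤ p →
        b (.inl p) = d p then ∏ x ∈ R, fourierFactor x (b (.inl x.1)) (d x.2) else 0) else 0 := by
    intro c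
    rw [partialFourier, ← ite_and]
    refine if_congr ?_ (Finset.prod_congr rfl fun x hx => ?_) rfl
    · constructor
      · rintro ⟨h1, h2⟩
        refine ⟨by simpa using h2 s le_rfl, fun i => by simpa using h1 i, fun p hp => ?_⟩
        have hps : p ≠ s := by rintro rfl; omega
        simpa [hps] using h2 p (by omega)
      · rintro ⟨rfl, h1, h2⟩
        refine ⟨fun i => by simpa using h1 i, fun p hp => ?_⟩
        by_cases hps : p = s
        · subst hps; simp
        · simpa [hps] using h2 p (by
            have : (p : ℕ) ≠ s := fun h => hps (Fin.ext h)
            omega)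
    · have : x.1 ≠ s := (hR x hx).ne
      simp [this]
  have h2 : (s, s) ∉ R := fun h => lt_irrefl _ (hR _ h)
  simp only [hadamardLayer, HybridLayer.step, List.foldl_cons, List.foldl_nil,
    ControlledGate.apply, QGate.apply, h1, mul_ite, mul_zero, Finset.sum_ite_eq', Finset.mem_univ,
    if_true]
  rw [partialFourier, Finset.prod_insert h2]
  simp only [hadamard, Matrix.of_apply, fourierFactor, if_true, Nat.add_sub_cancel_left]

/-- The larger qubit of each pair still holds its input bit, by `hm`, so that the diagonal gate
depends on the output bit `p` and the input bit `q` as `fourierFactor` demands. -/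
theorem step_controlledPhaseLayer (d : Fin k → Bool) (R : Finset (Fin k × Fin k)) (m t : ℕ)
    (hR : ∀ x ∈ R, ¬ (x.1 < x.2 ∧ (x.1 + x.2 : ℕ) = t))
    (hm : ∀ p q : Fin k, p < q → (p + q : ℕ) = t → m ≤ q) (inp : I → Bool) (u : Fin w → Bool) :
    HybridLayer.step inp (u, partialFourier a d R m) (controlledPhaseLayer I k a w t) =
      (u, partialFourier a d
        (R ∪ ({x | x.1 < x.2 ∧ (x.1 + x.2 : ℕ) = t} : Finset (Fin k × Fin k))) m) := by
  rw [controlledPhaseLayer, step_pairLayer_diagonal]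
  refine Prod.ext rfl (funext fun b => ?_)
  simp only [partialFourier, mul_ite, mul_zero]
  refine if_ctx_congr Iff.rfl (fun h => ?_) fun _ => rfl
  rw [Finset.prod_union (Finset.disjoint_left.2 fun x hx hx' =>
    hR x hx (Finset.mem_filter.1 hx').2), mul_comm]
  congr 1
  rw [Finset.prod_subtype (p := fun x : Fin k × Fin k => x.1 < x.2 ∧ (x.1 + x.2 : ℕ) = t) _
    fun x => by simp]
  refine Finset.prod_congr rfl fun x _ => ?_
  rw [fourierFactor, if_neg x.2.1.ne, one_mul, h.2 x.1.2 (hm _ _ x.2.1 x.2.2)]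

/-- The first `s` rounds of the Fourier transform, after a reversal of the order of the qubits. The
gate on the pair `p ≤ q` is applied at time `p + q`, so that gates of the same time act on disjoint
qubits; in a controlled phase gate, `p` has had its Hadamard gate and `q` has not. -/
noncomputable def fourierCircuit (I : Type) (k a w : ℕ) :
    (s : ℕ) → s ≤ k → HybridCircuit I (Fin w) (Fin k ⊕ Fin a)
  | 0, _ => [reversalLayer I k a w]
  | s + 1, h => fourierCircuit I k a w s (Nat.le_of_succ_le h) ++
      [hadamardLayer I a w ⟨s, h⟩, controlledPhaseLayer I k a w (2 * s),
        controlledPhaseLayer I k a w (2 * s + 1)]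

theorem depth_fourierCircuit (s : ℕ) (h : s ≤ k) :
    (fourierCircuit I k a w s h).depth = 3 * s + 1 := by
  induction s with
  | zero => rfl
  | succ s ih =>
    have := ih (Nat.le_of_succ_le h)
    simp only [HybridCircuit.depth, fourierCircuit, List.length_append, List.length_cons,
      List.length_nil] at *
    omega

theorem exists_quantum_of_mem_fourierCircuit (s : ℕ) (h : s ≤ k) :
    ∀ l ∈ fourierCircuit I k a w s h, ∃ G h', l = HybridLayer.quantum G h' := by
  induction s with
  | zero =>
    intro l hl
    obtain rfl := List.mem_singleton.1 hl
    exact ⟨_, _, rfl⟩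
  | succ s ih =>
    intro l hl
    rcases List.mem_append.1 hl with hl | hl
    · exact ih _ l hl
    · simp only [List.mem_cons, List.not_mem_nil, or_false] at hl
      rcases hl with rfl | rfl | rfl <;> exact ⟨_, _, rfl⟩

theorem run_fourierCircuit (s : ℕ) (h : s ≤ k) (inp : I → Bool) (u : Fin w → Bool)
    (b : Fin k → Bool) :
    (fourierCircuit I k a w s h).run inp (u, basisState (padded a b)) =
      (u, partialFourier a (fun j => b j.rev)
        {x | x.1 ≤ x.2 ∧ (x.1 + x.2 : ℕ) < 2 * s} s) := by
  induction s with
  | zero =>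
    have := step_reversalLayer (I := I) (a := a) inp u b
    simpa [HybridCircuit.run, fourierCircuit, partialFourier_empty] using this
  | succ s ih =>
    rw [fourierCircuit, HybridCircuit.run_append, ih, HybridCircuit.run_cons,
      HybridCircuit.run_cons, HybridCircuit.run_cons]
    have h1 := step_hadamardLayer (I := I) (a := a) (w := w) (fun j => b j.rev)
      {x : Fin k × Fin k | x.1 ≤ x.2 ∧ (x.1 + x.2 : ℕ) < 2 * s} ⟨s, h⟩ (by
        intro x hx
        simp only [Finset.mem_filter, Finset.mem_univ, true_and, Fin.le_def, Fin.lt_def] at *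
        omega) inp u
    rw [h1, step_controlledPhaseLayer, step_controlledPhaseLayer]
    · refine Prod.ext rfl ?_
      change partialFourier _ _ _ _ = _
      congr 1
      ext ⟨p, q⟩
      simp only [Finset.mem_filter, Finset.mem_univ, true_and, Finset.mem_union, Finset.mem_insert,
        Fin.le_def, Fin.lt_def, Prod.mk.injEq, Fin.ext_iff]
      omega
    · rintro ⟨p, q⟩ hx
      simp only [Finset.mem_filter, Finset.mem_univ, true_and, Finset.mem_union, Finset.mem_insert,
        Fin.le_def, Fin.lt_def, Prod.mk.injEq, Fin.ext_iff] at *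
      omega
    · intro p q hpq ht
      simp only [Fin.lt_def] at *
      omega
    · rintro ⟨p, q⟩ hx
      simp only [Finset.mem_filter, Finset.mem_univ, true_and, Finset.mem_insert,
        Fin.le_def, Fin.lt_def, Prod.mk.injEq, Fin.ext_iff] at *
      omega
    · intro p q hpq ht
      simp only [Fin.lt_def] at *
      omega

theorem prod_fourierFactor (v b : Fin k → Bool) :
    ∏ x : Fin k × Fin k with x.1 ≤ x.2 ∧ (x.1 + x.2 : ℕ) < 2 * k,
      fourierFactor x (v x.1) (b x.2.rev) =
    Complex.exp (2 * Real.pi * Complex.I * bitsValue b * bitsValue v / 2 ^ k) /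
      (Real.sqrt (2 ^ k) : ℂ) := by
  have h : ∀ x : Fin k × Fin k, (if x.1 ≤ x.2 ∧ (x.1 + x.2 : ℕ) < 2 * k then
      fourierFactor x (v x.1) (b x.2.rev) else 1) =
      (if x.1 = x.2 then (Real.sqrt 2 : ℂ)⁻¹ else 1) *
        if v x.1 && b x.2.rev then dyadicPhase (k - (x.2.rev + x.1)) else 1 := by
    rintro ⟨p, q⟩
    have h1 : k - ((q.rev : ℕ) + p) = q + 1 - p := by
      rw [Fin.val_rev]; omega
    simp only [h1]
    by_cases hpq : p ≤ q
    · rw [if_pos ⟨hpq, by omega⟩, fourierFactor]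
    · have h2 : p ≠ q := fun h => hpq h.le
      have h3 : (q : ℕ) + 1 - p = 0 := by
        rw [Fin.le_def] at hpq; omega
      simp [hpq, h2, h3, dyadicPhase_zero]
  have h2 : Real.sqrt (2 ^ k) = Real.sqrt 2 ^ k := by
    rw [Real.sqrt_eq_iff_mul_self_eq (by positivity) (by positivity), ← mul_pow,
      Real.mul_self_sqrt zero_le_two]
  rw [Finset.prod_filter]
  simp only [h, Finset.prod_mul_distrib]
  rw [exp_mul_bitsValue, Fintype.prod_prod_type, Fintype.prod_prod_type, div_eq_mul_inv, mul_comm]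
  congr 1
  · exact Finset.prod_congr rfl fun p _ => Equiv.prod_comp Fin.revPerm fun j : Fin k =>
      if v p && b j then dyadicPhase (k - (j + p)) else 1
  · simp [h2]

theorem partialFourier_eq_fourierState (z : Fin (2 ^ k)) :
    partialFourier a (fun j => bits k z j.rev)
      {x | x.1 ≤ x.2 ∧ (x.1 + x.2 : ℕ) < 2 * k} k = fourierState k a z := by
  funext b
  have h : ∀ p : Fin k, k ≤ (p : ℕ) → b (.inl p) = bits k z p.rev := fun p hp => by omega
  have h2 := prod_fourierFactor (fun j => b (.inl j)) (bits k z)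
  rw [bitsValue_bits z.2] at h2
  rw [partialFourier, h2]
  exact if_congr ⟨fun hb => hb.1, fun hb => ⟨hb, h⟩⟩ rfl rfl

/-- The Fourier transform and its inverse have circuits of depth `4 * k`. For `k = 0` these have to
be empty, without the layer that reverses the qubits. -/
theorem exists_fourierTransform (I : Type) (k a w : ℕ) :
    ∃ A A' : HybridCircuit I (Fin w) (Fin k ⊕ Fin a),
      ImplementsQFT A ∧ A.depth ≤ 4 * k ∧ ImplementsInverseQFT A' ∧ A'.depth ≤ 4 * k := by
  obtain ⟨A, hq, hA, hd⟩ : ∃ A : HybridCircuit I (Fin w) (Fin k ⊕ Fin a),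
      (∀ l ∈ A, ∃ G h, l = HybridLayer.quantum G h) ∧ ImplementsQFT A ∧ A.depth ≤ 4 * k := by
    rcases Nat.eq_zero_or_pos k with rfl | hk
    · refine ⟨[], by simp, fun inp u z => ?_, le_rfl⟩
      change basisState _ = _
      rw [← partialFourier_eq_fourierState, ← partialFourier_empty]
      congr 1
      exact funext fun j => j.elim0
    · refine ⟨fourierCircuit I k a w k le_rfl, exists_quantum_of_mem_fourierCircuit k le_rfl,
        fun inp u z => ?_, ?_⟩
      · rw [run_fourierCircuit, partialFourier_eq_fourierState]
      · rw [depth_fourierCircuit]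
        omega
  obtain ⟨A', h1, h2⟩ := A.exists_inverse hq
  refine ⟨A, A', hA, hd, fun inp u z => ?_, h1.trans_le hd⟩
  rw [← hA inp u z]
  exact h2 inp u _

end Fourier

end QMAC

theorem mainTheorem1 :
    ∃ c : ℕ, ∀ n k : ℕ, ∃ (a w : ℕ)
      (C : QMAC.HybridCircuit (Fin n × (Fin k ⊕ Fin k)) (Fin w) (Fin k ⊕ Fin a)),
      QMAC.PerformsMultiplyAdds C ∧
      C.depth ≤ c * (n + k) ∧
      k + a ≤ c * k ^ 3 ∧
      ∃ (σ : Fin a → Fin k)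
        (A F A' : QMAC.HybridCircuit (Fin n × (Fin k ⊕ Fin k)) (Fin w) (Fin k ⊕ Fin a))
        (M : QMAC.HybridCircuit (Fin k ⊕ Fin k) (Fin w) (Fin k ⊕ Fin a)),
        C = A ++ F ++ (List.finRange n).flatMap (fun i => M.relabel (Prod.mk i)) ++ F ++ A' ∧
        QMAC.ImplementsQFT A ∧ A.depth ≤ c * k ∧
        QMAC.ImplementsInverseQFT A' ∧ A'.depth ≤ c * k ∧
        QMAC.ImplementsFanOut σ F ∧ F.depth ≤ c * Nat.log 2 (k + 1) ∧
        QMAC.IsPhaseCircuit M ∧ QMAC.ImplementsMultiplyAddPhase σ M ∧ M.depth = 2 ∧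
        M.size ≤ c * k ^ 3 := by
  refine ⟨26, fun n k => ?_⟩
  obtain ⟨A, A', hA, hdA, hA', hdA'⟩ := QMAC.exists_fourierTransform
    (Fin n × (Fin k ⊕ Fin k)) k (k * (k * k)) (k * k)
  obtain ⟨F, hF, hdF⟩ := QMAC.exists_fanOut (Fin n × (Fin k ⊕ Fin k)) k (k * k)
  have hM := QMAC.implementsMultiplyAddPhase_productPhaseCircuit k
  refine ⟨k * (k * k), k * k, _, QMAC.performsMultiplyAdds_of_parts hA hA' hF hM, ?_, ?_,
    _, A, F, A', QMAC.productPhaseCircuit k, rfl, hA, by omega, hA', by omega, hF, by omega,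
    QMAC.isPhaseCircuit_productPhaseCircuit k, hM, rfl,
    (QMAC.size_productPhaseCircuit k).trans (Nat.mul_le_mul_right _ (by norm_num))⟩
  · have hlog : Nat.log 2 (k + 1) ≤ k := Nat.lt_succ_iff.1 (Nat.log_lt_self 2 k.succ_ne_zero)
    have hMs : ((List.finRange n).flatMap fun i => (QMAC.productPhaseCircuit k).relabel
        (Prod.mk i : Fin k ⊕ Fin k → Fin n × (Fin k ⊕ Fin k))).length = n * 2 := by
      simp [List.length_flatMap, QMAC.HybridCircuit.relabel, QMAC.productPhaseCircuit]
    simp only [QMAC.HybridCircuit.depth, List.length_append] at *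
    omega
  · have h3 : k * (k * k) = k ^ 3 := by ring
    have h1 : k ≤ k ^ 3 := Nat.le_self_pow (by norm_num) k
    omega
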